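/- Let $u_1,u_2\ge 1$ and consider the control system $$\dot x_1=x_2,\qquad \dot x_2=-u\,x_1+\frac1{x_1^3},\qquad x_1>0,$$ with Lebesgue measurable controls $u(t)\in[-u_1,u_2]$ a.e. A controlled trajectory $(x,u)$ on $[0,T]$ ($x$ absolutely continuous) is called an extremal if there are a constant $\lambda_0\le 0$ and a nowhere vanishing absolutely continuous $\lambda=(\lambda_1,\lambda_2):[0,T]\to\mathbb R^2$ such that, with $H(\lambda_0,\lambda,x,v)=\lambda_0+\lambda_1x_2+\lambda_2(x_1^{-3}-v x_1)$, for almost every $t\in[0,T]$: $\dot\lambda=-\partial H/\partial x$, $H(\lambda_0,\lambda(t),x(t),\cdot)$ attains its maximum over $[-u_1,u_2]$ at $u(t)$, and $H(\lambda_0,\lambda(t),x(t),u(t))=0$. A switching time is a time in $(0,T)$ at which $u$ switches between the values $-u_1$ and $u_2$, i.e. $u$ equals one of them a.e. just before and the other a.e. just after; the state at that time is the switching point. Let $(x,u)$ be an extremal on $[0,T]$ and let $t<t'$ be consecutive switching times. Then 1. $\dfrac{x_2(t')}{x_1(t')}=-\dfrac{x_2(t)}{x_1(t)}$. 2. If $(x,u)$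 transfers $(1,0)$ to $(\gamma,0)$ for some $\gamma>1$, then this ratio is nonzero, so that along the sequence of switching points the ratio $x_2/x_1$ has constant magnitude and strictly alternating sign. 3. If, moreover, the extremal is time-optimal for this transfer (no controlled trajectory goes from $(1,0)$ to $(\gamma,0)$ in a time less than $T$), then the two switching points are not symmetric with respect to the $x_1$-axis: $x(t')\ne(x_1(t),-x_2(t))$. -/

import Mathlib

open MeasureTheory Set

namespace AtomCooling

/-- The control system `ẋ₁ = x₂`, `ẋ₂ = -v x₁ + 1 / x₁³`: its velocity at the state `p` under the
control value `v`. -/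
noncomputable def velocity (p : ℝ × ℝ) (v : ℝ) : ℝ × ℝ :=
  (p.2, -v * p.1 + 1 / p.1 ^ 3)

/-- `(x, u)` is a controlled trajectory on `[0, T]` in the state space `x₁ > 0`: `u` is Lebesgue
measurable with values in `[-u₁, u₂]` almost everywhere, and `x` is an absolutely continuous
solution of the control system. -/
structure IsControlledTrajectory (u₁ u₂ T : ℝ) (x : ℝ → ℝ × ℝ) (u : ℝ → ℝ) : Prop where
  time_nonneg : 0 ≤ T
  control_measurable : AEMeasurable u (volume.restrict (Icc 0 T))
  control_mem : ∀ᵐ t ∂(volume.restrict (Icc 0 T)), u t ∈ Icc (-u₁) u₂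
  state_ac : AbsolutelyContinuousOnInterval x 0 T
  state_pos : ∀ t ∈ Icc 0 T, 0 < (x t).1
  state_eq : ∀ᵐ t ∂(volume.restrict (Icc 0 T)), HasDerivAt x (velocity (x t) (u t)) t

/-- The control Hamiltonian `H(l₀, l, p, v) = l₀ + ⟨l, f(p) + v g(p)⟩`. -/
noncomputable def hamiltonian (l₀ : ℝ) (l p : ℝ × ℝ) (v : ℝ) : ℝ :=
  l₀ + (l.1 * (velocity p v).1 + l.2 * (velocity p v).2)

/-- The right-hand side `-∂H/∂x` of the adjoint equation
(see `hasDerivAt_hamiltonian_fst`, `hasDerivAt_hamiltonian_snd`). -/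
noncomputable def adjointVelocity (l p : ℝ × ℝ) (v : ℝ) : ℝ × ℝ :=
  (l.2 * (v + 3 / p.1 ^ 4), -l.1)

theorem hasDerivAt_hamiltonian_fst (l₀ : ℝ) (l p : ℝ × ℝ) (v : ℝ) (hp : 0 < p.1) :
    HasDerivAt (fun a => hamiltonian l₀ l (a, p.2) v) (-(adjointVelocity l p v).1) p.1 := by
  have h0 : p.1 ^ 3 ≠ 0 := by positivity
  have h1 : HasDerivAt (fun a : ℝ => 1 / a ^ 3) (-(3 * p.1 ^ 2) / (p.1 ^ 3) ^ 2) p.1 := by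
    simpa using (hasDerivAt_pow 3 p.1).fun_inv h0
  have h2 := (((((hasDerivAt_id p.1).const_mul (-v)).fun_add h1).const_mul l.2).const_add
    (l.1 * p.2)).const_add l₀
  refine HasDerivAt.congr_deriv h2 ?_
  simp only [adjointVelocity]
  field_simp
  ring

theorem hasDerivAt_hamiltonian_snd (l₀ : ℝ) (l p : ℝ × ℝ) (v : ℝ) :
    HasDerivAt (fun b => hamiltonian l₀ l (p.1, b) v) (-(adjointVelocity l p v).2) p.2 := by
  have h2 := ((((hasDerivAt_id p.2).const_mul l.1)).add_const
    (l.2 * (-v * p.1 + 1 / p.1 ^ 3))).const_add l₀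
  refine HasDerivAt.congr_deriv h2 ?_
  simp [adjointVelocity]

/-- `(l₀, l)` are multipliers for `(x, u)` on `[0, T]` in the sense of the maximum principle. -/
structure IsMultiplier (u₁ u₂ T : ℝ) (x : ℝ → ℝ × ℝ) (u : ℝ → ℝ) (l₀ : ℝ) (l : ℝ → ℝ × ℝ) :
    Prop where
  nonpos : l₀ ≤ 0
  ac : AbsolutelyContinuousOnInterval l 0 T
  ne_zero : ∀ t ∈ Icc 0 T, l t ≠ 0
  adjoint_eq : ∀ᵐ t ∂(volume.restrict (Icc 0 T)),
    HasDerivAt l (adjointVelocity (l t) (x t) (u t)) t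
  maximality : ∀ᵐ t ∂(volume.restrict (Icc 0 T)), ∀ v ∈ Icc (-u₁) u₂,
    hamiltonian l₀ (l t) (x t) v ≤ hamiltonian l₀ (l t) (x t) (u t)
  hamiltonian_eq_zero : ∀ᵐ t ∂(volume.restrict (Icc 0 T)), hamiltonian l₀ (l t) (x t) (u t) = 0

/-- An extremal: a controlled trajectory that admits multipliers (normal or abnormal). -/
def IsExtremal (u₁ u₂ T : ℝ) (x : ℝ → ℝ × ℝ) (u : ℝ → ℝ) : Prop :=
  IsControlledTrajectory u₁ u₂ T x u ∧
    ∃ (l₀ : ℝ) (l : ℝ → ℝ × ℝ), IsMultiplier u₁ u₂ T x u l₀ l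

/-- `(x, u)` is a controlled trajectory on `[0, T]` from `(1, 0)` to `(γ, 0)`. -/
def IsTransfer (u₁ u₂ γ T : ℝ) (x : ℝ → ℝ × ℝ) (u : ℝ → ℝ) : Prop :=
  IsControlledTrajectory u₁ u₂ T x u ∧ x 0 = (1, 0) ∧ x T = (γ, 0)

/-- `(x, u)` goes from `(1, 0)` to `(γ, 0)` in the minimum time, and this time is `T`. -/
def IsTimeOptimal (u₁ u₂ γ T : ℝ) (x : ℝ → ℝ × ℝ) (u : ℝ → ℝ) : Prop :=
  IsTransfer u₁ u₂ γ T x u ∧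
    ∀ (T' : ℝ) (x' : ℝ → ℝ × ℝ) (u' : ℝ → ℝ), IsTransfer u₁ u₂ γ T' x' u' → T ≤ T'

/-- At the time `t` in the open interval `(0, T)` the control switches from one of the bang values
`-u₁`, `u₂` to the other. -/
def IsSwitchingTime (u₁ u₂ T : ℝ) (u : ℝ → ℝ) (t : ℝ) : Prop :=
  t ∈ Ioo 0 T ∧ ∃ a b : ℝ, ((a = -u₁ ∧ b = u₂) ∨ (a = u₂ ∧ b = -u₁)) ∧ ∃ ε > 0,
    (∀ᵐ s ∂(volume.restrict (Ioo (t - ε) t)), u s = a) ∧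
    (∀ᵐ s ∂(volume.restrict (Ioo t (t + ε))), u s = b)

/-- `t < t'` are switching times with no switching time between them. -/
def AreConsecutiveSwitchingTimes (u₁ u₂ T : ℝ) (u : ℝ → ℝ) (t t' : ℝ) : Prop :=
  IsSwitchingTime u₁ u₂ T u t ∧ IsSwitchingTime u₁ u₂ T u t' ∧ t < t' ∧
    ∀ s ∈ Ioo t t', ¬ IsSwitchingTime u₁ u₂ T u s

end AtomCooling

/-! Put p = l₁x₁ + l₂x₂ and q = l₂/x₁. The control cancels from their derivatives, p' = 4q/x₁² and
q' = -p/x₁², so p² + 4q² is constant along every extremal (`firstIntegral_eq`).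

Switching times are exactly the interior zeros of l₂. There H = 0 reads l₀ + l₁x₂ = 0 and the first
integral is (l₁x₁)². Consecutive zeros of l₂, where l₂' = -l₁ ≠ 0, are crossed in opposite
directions; hence l₁x₁ changes sign while l₁x₂ = -l₀ does not, and the ratio x₂/x₁ changes sign.

If x₂ = 0 at a switching time then l₀ = 0. An abnormal extremal with both ends on the x₁-axis has l₂
≤ 0 throughout (`snd_nonpos_of_abnormal`), which is impossible where l₂ crosses zero.

For the third claim, time reversal with reflection in the x₁-axis maps the Hamiltonian flow to
itself. If the two switching points were mirror images, the adjoints would match too, so by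
uniqueness the arc after t' would mirror the arc before t. Then the trajectory either returns to (1,
0) or visits (γ, 0) early, and a shorter transfer exists. -/

section

/-! ### Absolutely continuous functions and one-sided signs. -/

open Filter Topology

/-- Subtracting a primitive of `g` leaves an absolutely continuous function with derivative zero
a.e., hence a constant. This turns a.e. equations with continuous right-hand side into pointwise
ones. -/
theorem AbsolutelyContinuousOnInterval.hasDerivWithinAt_of_ae {E : Type*} [NormedAddCommGroup E]
    [NormedSpace ℝ E] [CompleteSpace E] {f g : ℝ → E} {a b : ℝ} (hab : a ≤ b)
    (hf : AbsolutelyContinuousOnInterval f a b) (hg : ContinuousOn g (Icc a b))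
    (hfg : ∀ᵐ t ∂(volume.restrict (Icc a b)), HasDerivAt f (g t) t) :
    ∀ t ∈ Icc a b, HasDerivWithinAt f (g t) (Icc a b) t := by
  set G : ℝ → E := IccExtend hab ((Icc a b).domRestrict g) with hG
  have hGc : Continuous G := (continuousOn_iff_continuous_domRestrict.1 hg).Icc_extend'
  have hGg : ∀ t ∈ Icc a b, G t = g t := fun t ht => by
    rw [hG, IccExtend_of_mem _ _ ht]; rfl
  set P : ℝ → E := fun t => ∫ s in a..t, G s with hP
  have hPd : ∀ t, HasDerivAt P (G t) t := fun t =>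
    intervalIntegral.integral_hasDerivAt_right (hGc.intervalIntegrable _ _)
      hGc.aestronglyMeasurable.stronglyMeasurableAtFilter hGc.continuousAt
  have hPC : ContDiff ℝ 1 P := by
    rw [contDiff_one_iff_deriv]
    refine ⟨fun t => (hPd t).differentiableAt, ?_⟩
    have : deriv P = G := funext fun t => (hPd t).deriv
    rw [this]; exact hGc
  have hD : AbsolutelyContinuousOnInterval (f - P) a b :=
    hf.sub hPC.contDiffOn.absolutelyContinuousOnInterval
  obtain ⟨C, hC⟩ := hD.const_of_ae_hasDerivAt_zero (by
    rw [ae_restrict_iff' measurableSet_Icc] at hfg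
    filter_upwards [hfg] with t ht h
    rw [uIcc_of_le hab] at h
    have := (ht h).sub (hPd t)
    rwa [hGg t h, sub_self] at this)
  intro t ht
  have h1 : HasDerivWithinAt (fun s => P s + C) (g t) (Icc a b) t := by
    rw [← hGg t ht]; exact ((hPd t).add_const C).hasDerivWithinAt
  have h2 : ∀ s ∈ Icc a b, f s = P s + C := fun s hs => by
    have := hC s (by rwa [uIcc_of_le hab])
    rw [← this]; simp
  exact h1.congr h2 (h2 t ht)

theorem LipschitzWith.comp_absolutelyContinuousOnInterval {X Y : Type*} [PseudoMetricSpace X]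
    [PseudoMetricSpace Y] {K : NNReal} {φ : X → Y} (hφ : LipschitzWith K φ) {f : ℝ → X} {a b : ℝ}
    (hf : AbsolutelyContinuousOnInterval f a b) :
    AbsolutelyContinuousOnInterval (fun t => φ (f t)) a b := by
  refine squeeze_zero (fun E => Finset.sum_nonneg fun i _ => dist_nonneg) (fun E => ?_)
    (by simpa using Tendsto.const_mul (K : ℝ) hf)
  rw [Finset.mul_sum]
  exact Finset.sum_le_sum fun i _ => hφ.dist_le_mul _ _

theorem AbsolutelyContinuousOnInterval.comp_const_add {X : Type*} [PseudoMetricSpace X]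
    {f : ℝ → X} {a b : ℝ} (c : ℝ) (hf : AbsolutelyContinuousOnInterval f (c + a) (c + b)) :
    AbsolutelyContinuousOnInterval (fun t => f (c + t)) a b := by
  rw [absolutelyContinuousOnInterval_iff] at hf ⊢
  intro ε hε
  obtain ⟨δ, hδ, h⟩ := hf ε hε
  refine ⟨δ, hδ, fun E hE hlt => ?_⟩
  refine h (E.1, fun i => (c + (E.2 i).1, c + (E.2 i).2)) ⟨fun i hi => ?_, ?_⟩ (by simpa using hlt)
  · have := hE.1 i hi
    simp only [mem_uIcc] at this ⊢
    grind
  · intro i hi j hj hij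
    have := hE.2 hi hj hij
    simp only [Function.onFun, Set.disjoint_left] at this ⊢
    intro y hy hy'
    refine this (a := y - c) ?_ ?_
    · simp only [mem_uIoc] at hy ⊢; grind
    · simp only [mem_uIoc] at hy' ⊢; grind

theorem ae_restrict_Icc_const_add {p : ℝ → Prop} {a b : ℝ} (c : ℝ)
    (h : ∀ᵐ t ∂(volume.restrict (Icc (c + a) (c + b))), p t) :
    ∀ᵐ t ∂(volume.restrict (Icc a b)), p (c + t) := by
  rw [ae_restrict_iff' measurableSet_Icc] at h ⊢
  have := (measurePreserving_add_left volume c).quasiMeasurePreserving.ae h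
  filter_upwards [this] with t ht h
  exact ht ⟨by linarith [h.1], by linarith [h.2]⟩

theorem eventually_pos_nhdsGT_of_hasDerivWithinAt {f : ℝ → ℝ} {f' a b t : ℝ} (ht : t ∈ Ico a b)
    (hf : HasDerivWithinAt f f' (Icc a b) t) (h : 0 < f t ∨ f t = 0 ∧ 0 < f') :
    ∀ᶠ s in 𝓝[>] t, 0 < f s := by
  have hle : 𝓝[>] t ≤ 𝓝[Icc a b] t := by
    rw [← nhdsWithin_Ioc_eq_nhdsGT ht.2]
    exact nhdsWithin_mono _ fun s hs => ⟨ht.1.trans hs.1.le, hs.2⟩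
  rcases h with h | ⟨h0, h1⟩
  · exact (hf.continuousWithinAt.mono_left hle).eventually_const_lt h
  · have hs := (hasDerivWithinAt_iff_tendsto_slope' (by simp)).1
      (hf.mono fun s (hs : s ∈ Ioc t b) => ⟨ht.1.trans hs.1.le, hs.2⟩)
    rw [nhdsWithin_Ioc_eq_nhdsGT ht.2] at hs
    have := hs.eventually_const_lt h1
    filter_upwards [this, self_mem_nhdsWithin] with s hs hst
    rw [slope_def_field, h0, sub_zero] at hs
    have : 0 < s - t := sub_pos.2 hst
    exact (div_pos_iff_of_pos_right this).1 hs

theorem eventually_neg_nhdsGT_of_hasDerivWithinAt {f : ℝ → ℝ} {f' a b t : ℝ} (ht : t ∈ Ico a b)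
    (hf : HasDerivWithinAt f f' (Icc a b) t) (h : f t < 0 ∨ f t = 0 ∧ f' < 0) :
    ∀ᶠ s in 𝓝[>] t, f s < 0 := by
  simpa using eventually_pos_nhdsGT_of_hasDerivWithinAt ht hf.fun_neg (by simpa using h)

theorem eventually_pos_nhdsLT_of_hasDerivWithinAt {f : ℝ → ℝ} {f' a b t : ℝ} (ht : t ∈ Ioc a b)
    (hf : HasDerivWithinAt f f' (Icc a b) t) (h : 0 < f t ∨ f t = 0 ∧ f' < 0) :
    ∀ᶠ s in 𝓝[<] t, 0 < f s := by
  have h1 : HasDerivWithinAt (fun s => f (-s)) (-f') (Icc (-b) (-a)) (-t) := by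
    have := HasDerivWithinAt.scomp (-t) (t' := Icc a b) (h := fun s => -s) (h' := -1)
      (s := Icc (-b) (-a)) (by simpa using hf) (hasDerivWithinAt_neg _ _)
      (fun s hs => ⟨by linarith [hs.2], by linarith [hs.1]⟩)
    simpa using! this
  have h2 := eventually_pos_nhdsGT_of_hasDerivWithinAt ⟨by linarith [ht.2], by linarith [ht.1]⟩ h1
    (by simpa using h)
  have h3 : Tendsto (fun s : ℝ => -s) (𝓝[<] t) (𝓝[>] (-t)) := tendsto_neg_nhdsLT
  simpa using h3.eventually h2

theorem eventually_neg_nhdsLT_of_hasDerivWithinAt {f : ℝ → ℝ} {f' a b t : ℝ} (ht : t ∈ Ioc a b)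
    (hf : HasDerivWithinAt f f' (Icc a b) t) (h : f t < 0 ∨ f t = 0 ∧ 0 < f') :
    ∀ᶠ s in 𝓝[<] t, f s < 0 := by
  simpa using eventually_pos_nhdsLT_of_hasDerivWithinAt ht hf.fun_neg (by simpa using h)

/-! ### First integral, vanishing Hamiltonian and control law along extremals. -/

namespace AtomCooling

variable {u₁ u₂ T l₀ : ℝ} {x l : ℝ → ℝ × ℝ} {u : ℝ → ℝ}

theorem continuousOn_velocity {s : Set ℝ} (hx : ContinuousOn x s) (hpos : ∀ t ∈ s, 0 < (x t).1)
    (v : ℝ) : ContinuousOn (fun t => velocity (x t) v) s := by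
  have h3 : ∀ t ∈ s, (x t).1 ^ 3 ≠ 0 := fun t ht => (pow_pos (hpos t ht) 3).ne'
  unfold velocity
  exact hx.snd.prodMk ((hx.fst.const_mul (-v)).add (continuousOn_const.div (hx.fst.pow 3) h3))

theorem continuousOn_adjointVelocity {s : Set ℝ} (hx : ContinuousOn x s) (hl : ContinuousOn l s)
    (hpos : ∀ t ∈ s, 0 < (x t).1) (v : ℝ) :
    ContinuousOn (fun t => adjointVelocity (l t) (x t) v) s := by
  have h4 : ∀ t ∈ s, (x t).1 ^ 4 ≠ 0 := fun t ht => (pow_pos (hpos t ht) 4).ne'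
  unfold adjointVelocity
  exact (hl.snd.mul (continuousOn_const.add (continuousOn_const.div (hx.fst.pow 4) h4))).prodMk
    hl.fst.neg

theorem continuousOn_hamiltonian {s : Set ℝ} (hx : ContinuousOn x s) (hl : ContinuousOn l s)
    (hpos : ∀ t ∈ s, 0 < (x t).1) (v : ℝ) :
    ContinuousOn (fun t => hamiltonian l₀ (l t) (x t) v) s := by
  have h := continuousOn_velocity hx hpos v
  unfold hamiltonian
  exact continuousOn_const.add ((hl.fst.mul h.fst).add (hl.snd.mul h.snd))

namespace IsControlledTrajectory

theorem continuousOn (hx : IsControlledTrajectory u₁ u₂ T x u) : ContinuousOn x (Icc 0 T) := by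
  simpa [uIcc_of_le hx.time_nonneg] using hx.state_ac.continuousOn

theorem hasDerivWithinAt_fst (hx : IsControlledTrajectory u₁ u₂ T x u) :
    ∀ t ∈ Icc 0 T, HasDerivWithinAt (fun s => (x s).1) (x t).2 (Icc 0 T) t := by
  refine AbsolutelyContinuousOnInterval.hasDerivWithinAt_of_ae hx.time_nonneg
    (LipschitzWith.prod_fst.comp_absolutelyContinuousOnInterval hx.state_ac) hx.continuousOn.snd ?_
  filter_upwards [hx.state_eq] with t ht
  exact ht.fst

theorem restrict_const_add (hx : IsControlledTrajectory u₁ u₂ T x u) {a b : ℝ} (ha : 0 ≤ a)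
    (hb : 0 ≤ b) (hab : a + b ≤ T) :
    IsControlledTrajectory u₁ u₂ b (fun s => x (a + s)) (fun s => u (a + s)) where
  time_nonneg := hb
  control_measurable := by
    have hm := hx.control_measurable.mono_measure
      (Measure.restrict_mono (show Icc (a + 0) (a + b) ⊆ Icc 0 T from
        Icc_subset_Icc (by linarith) hab) le_rfl)
    refine hm.comp_quasiMeasurePreserving ⟨measurable_const_add a, ?_⟩
    intro s hs
    have h1 : ∀ᵐ t ∂(volume.restrict (Icc (a + 0) (a + b))), t ∉ s := by
      rw [ae_iff]; simpa using hs
    have h2 := ae_restrict_Icc_const_add a h1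
    rw [ae_iff] at h2
    simp only [not_not] at h2
    exact ((measurableEmbedding_addLeft a).map_apply _ _).trans h2
  control_mem := by
    refine ae_restrict_Icc_const_add (p := fun t => u t ∈ Icc (-u₁) u₂) a
      (ae_restrict_of_ae_restrict_of_subset (Icc_subset_Icc (by linarith) hab) hx.control_mem)
  state_ac := by
    refine AbsolutelyContinuousOnInterval.comp_const_add a (hx.state_ac.mono ?_)
    rw [uIcc_of_le (by linarith), uIcc_of_le (by linarith)]
    exact Icc_subset_Icc (by linarith) hab
  state_pos t ht := hx.state_pos _ ⟨by linarith [ht.1], by linarith [ht.2]⟩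
  state_eq := by
    have h := ae_restrict_Icc_const_add (p := fun t => HasDerivAt x (velocity (x t) (u t)) t)
      (a := 0) (b := b) a
      (ae_restrict_of_ae_restrict_of_subset (Icc_subset_Icc (by linarith) hab) hx.state_eq)
    filter_upwards [h] with t ht
    exact ht.comp_const_add a t

end IsControlledTrajectory

namespace IsMultiplier

theorem continuousOn (hT : 0 ≤ T) (hl : IsMultiplier u₁ u₂ T x u l₀ l) :
    ContinuousOn l (Icc 0 T) := by
  simpa [uIcc_of_le hT] using hl.ac.continuousOn

theorem hasDerivWithinAt_snd (hT : 0 ≤ T) (hl : IsMultiplier u₁ u₂ T x u l₀ l) :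
    ∀ t ∈ Icc 0 T, HasDerivWithinAt (fun s => (l s).2) (-(l t).1) (Icc 0 T) t := by
  refine AbsolutelyContinuousOnInterval.hasDerivWithinAt_of_ae hT
    (LipschitzWith.prod_snd.comp_absolutelyContinuousOnInterval hl.ac)
    (hl.continuousOn hT).fst.neg ?_
  filter_upwards [hl.adjoint_eq] with t ht
  exact ht.snd

/-- The terms in `u` cancel, so the derivative is continuous and exists at every time, although
neither `(l s).1` nor `(x s).2` need be differentiable at a switch. -/
theorem hasDerivWithinAt_pairing (hx : IsControlledTrajectory u₁ u₂ T x u)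
    (hl : IsMultiplier u₁ u₂ T x u l₀ l) :
    ∀ t ∈ Icc 0 T, HasDerivWithinAt (fun s => (l s).1 * (x s).1 + (l s).2 * (x s).2)
      (4 * (l t).2 / (x t).1 ^ 3) (Icc 0 T) t := by
  have hfst : ∀ f : ℝ → ℝ × ℝ, AbsolutelyContinuousOnInterval f 0 T →
      AbsolutelyContinuousOnInterval (fun s => (f s).1) 0 T := fun f hf =>
    LipschitzWith.prod_fst.comp_absolutelyContinuousOnInterval hf
  have hsnd : ∀ f : ℝ → ℝ × ℝ, AbsolutelyContinuousOnInterval f 0 T →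
      AbsolutelyContinuousOnInterval (fun s => (f s).2) 0 T := fun f hf =>
    LipschitzWith.prod_snd.comp_absolutelyContinuousOnInterval hf
  refine AbsolutelyContinuousOnInterval.hasDerivWithinAt_of_ae hx.time_nonneg
    (((hfst l hl.ac).fun_mul (hfst x hx.state_ac)).fun_add
      ((hsnd l hl.ac).fun_mul (hsnd x hx.state_ac)))
    (((hl.continuousOn hx.time_nonneg).snd.const_mul 4).div (hx.continuousOn.fst.pow 3)
      fun t ht => (pow_pos (hx.state_pos t ht) 3).ne') ?_
  filter_upwards [hx.state_eq, hl.adjoint_eq, ae_restrict_mem measurableSet_Icc] with t h1 h2 ht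
  have hpos := hx.state_pos t ht
  have hx₁ : HasDerivAt (fun s => (x s).1) (velocity (x t) (u t)).1 t := h1.fst
  have hx₂ : HasDerivAt (fun s => (x s).2) (velocity (x t) (u t)).2 t := h1.snd
  have hl₁ : HasDerivAt (fun s => (l s).1) (adjointVelocity (l t) (x t) (u t)).1 t := h2.fst
  have hl₂ : HasDerivAt (fun s => (l s).2) (adjointVelocity (l t) (x t) (u t)).2 t := h2.snd
  refine ((hl₁.fun_mul hx₁).fun_add (hl₂.fun_mul hx₂)).congr_deriv ?_
  simp only [velocity, adjointVelocity]
  field_simp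
  ring

/-- A first integral along extremals, valid for every control. -/
theorem firstIntegral_eq (hx : IsControlledTrajectory u₁ u₂ T x u)
    (hl : IsMultiplier u₁ u₂ T x u l₀ l) {t : ℝ} (ht : t ∈ Icc 0 T) :
    ((l t).1 * (x t).1 + (l t).2 * (x t).2) ^ 2 + 4 * ((l t).2 / (x t).1) ^ 2 =
    ((l 0).1 * (x 0).1 + (l 0).2 * (x 0).2) ^ 2 + 4 * ((l 0).2 / (x 0).1) ^ 2 := by
  have hd : ∀ t ∈ Icc 0 T, HasDerivWithinAt (fun t => ((l t).1 * (x t).1 + (l t).2 * (x t).2) ^ 2 +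
      4 * ((l t).2 / (x t).1) ^ 2) 0 (Icc 0 T) t := by
    intro t ht
    have hpos := hx.state_pos t ht
    -- In the notation p, q: 2p · 4q/x₁² + 8q · (-p/x₁²) = 0.
    refine (((hl.hasDerivWithinAt_pairing hx t ht).fun_pow 2).fun_add
      ((((hl.hasDerivWithinAt_snd hx.time_nonneg t ht).fun_div (hx.hasDerivWithinAt_fst t ht)
        hpos.ne').fun_pow 2).const_mul 4)).congr_deriv ?_
    have := hpos.ne'
    simp only [Nat.cast_ofNat, Nat.add_one_sub_one, pow_one]
    field_simp
    ring
  have h := (convex_Icc 0 T).norm_image_sub_le_of_norm_hasDerivWithin_le hd (C := 0) (by simp)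
    ⟨le_rfl, hx.time_nonneg⟩ ht
  rw [zero_mul, norm_le_zero_iff, sub_eq_zero] at h
  exact h

/-- H is affine in the control, so its maximum is attained at an endpoint of the control interval.
The maximum no longer involves `u`, so it is continuous in time and its a.e. vanishing holds
everywhere, switching times included. -/
theorem max_hamiltonian_eq_zero (hx : IsControlledTrajectory u₁ u₂ T x u)
    (hl : IsMultiplier u₁ u₂ T x u l₀ l) (hT : 0 < T) (hu : -u₁ ≤ u₂) {t : ℝ} (ht : t ∈ Icc 0 T) :
    max (hamiltonian l₀ (l t) (x t) (-u₁)) (hamiltonian l₀ (l t) (x t) u₂) = 0 := by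
  have hc := hl.continuousOn hT.le
  refine Measure.eqOn_Icc_of_ae_eq volume hT.ne (f := fun s =>
    max (hamiltonian l₀ (l s) (x s) (-u₁)) (hamiltonian l₀ (l s) (x s) u₂))
    (g := fun _ => (0 : ℝ)) ?_ (ContinuousOn.sup (continuousOn_hamiltonian hx.continuousOn hc hx.state_pos _)
      (continuousOn_hamiltonian hx.continuousOn hc hx.state_pos _)) continuousOn_const ht
  filter_upwards [hl.maximality, hl.hamiltonian_eq_zero, hx.control_mem] with s h1 h2 h3
  refine le_antisymm (max_le ?_ ?_) ?_
  · exact h2 ▸ h1 _ ⟨le_rfl, hu⟩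
  · exact h2 ▸ h1 _ ⟨hu, le_rfl⟩
  · rw [le_max_iff]
    by_contra! h
    simp only [hamiltonian, velocity] at h2 h
    rcases le_or_gt 0 ((l s).2 * (x s).1) with h4 | h4
    · nlinarith [mul_nonneg h4 (sub_nonneg.2 h3.1), h.1]
    · nlinarith [mul_nonneg (neg_pos.2 h4).le (sub_nonneg.2 h3.2), h.2]

/-- The slope of H in the control is -l₂x₁, with x₁ > 0. -/
theorem ae_control_eq (hx : IsControlledTrajectory u₁ u₂ T x u)
    (hl : IsMultiplier u₁ u₂ T x u l₀ l) :
    ∀ᵐ s ∂(volume.restrict (Icc 0 T)), (0 < (l s).2 → u s = -u₁) ∧ ((l s).2 < 0 → u s = u₂) := by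
  filter_upwards [hl.maximality, hx.control_mem, ae_restrict_mem measurableSet_Icc] with s h1 h3 hs
  have hpos := hx.state_pos s hs
  have hu : -u₁ ≤ u₂ := h3.1.trans h3.2
  simp only [hamiltonian, velocity] at h1
  refine ⟨fun h => le_antisymm ?_ h3.1, fun h => le_antisymm h3.2 ?_⟩
  · have h4 := h1 _ ⟨le_rfl, hu⟩
    by_contra! h5
    nlinarith [mul_pos (mul_pos h hpos) (sub_pos.2 h5)]
  · have h4 := h1 _ ⟨hu, le_rfl⟩
    by_contra! h5
    nlinarith [mul_pos (mul_pos (neg_pos.2 h) hpos) (sub_pos.2 h5)]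

end IsMultiplier

/-- `v` is the bang control prescribed by the sign of the adjoint variable `l₂` on `(a, b)`. -/
def IsBangControl (u₁ u₂ : ℝ) (l : ℝ → ℝ × ℝ) (a b v : ℝ) : Prop :=
  (v = -u₁ ∧ ∀ s ∈ Ioo a b, 0 < (l s).2) ∨ (v = u₂ ∧ ∀ s ∈ Ioo a b, (l s).2 < 0)

namespace IsMultiplier

theorem hasDerivWithinAt_of_isBangControl (hx : IsControlledTrajectory u₁ u₂ T x u)
    (hl : IsMultiplier u₁ u₂ T x u l₀ l) {a b v : ℝ} (ha : 0 ≤ a) (hab : a ≤ b) (hb : b ≤ T)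
    (hv : IsBangControl u₁ u₂ l a b v) {t : ℝ} (ht : t ∈ Icc a b) :
    HasDerivWithinAt x (velocity (x t) v) (Icc a b) t ∧
      HasDerivWithinAt l (adjointVelocity (l t) (x t) v) (Icc a b) t := by
  have hsub : Icc a b ⊆ Icc 0 T := Icc_subset_Icc ha hb
  have hu : ∀ᵐ s ∂(volume.restrict (Icc a b)), u s = v := by
    have h := ae_restrict_of_ae_restrict_of_subset hsub (hl.ae_control_eq hx)
    rw [← restrict_Ioo_eq_restrict_Icc] at h ⊢
    filter_upwards [h, ae_restrict_mem measurableSet_Ioo] with s hs hm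
    rcases hv with ⟨hv, h⟩ | ⟨hv, h⟩
    exacts [hv ▸ hs.1 (h s hm), hv ▸ hs.2 (h s hm)]
  have hxc := hx.continuousOn.mono hsub
  have hlc := (hl.continuousOn hx.time_nonneg).mono hsub
  have hsub' : uIcc a b ⊆ uIcc 0 T := by rwa [uIcc_of_le hab, uIcc_of_le hx.time_nonneg]
  refine ⟨AbsolutelyContinuousOnInterval.hasDerivWithinAt_of_ae hab (hx.state_ac.mono hsub')
    (continuousOn_velocity hxc (fun s hs => hx.state_pos s (hsub hs)) v) ?_ t ht,
    AbsolutelyContinuousOnInterval.hasDerivWithinAt_of_ae hab (hl.ac.mono hsub')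
    (continuousOn_adjointVelocity hxc hlc (fun s hs => hx.state_pos s (hsub hs)) v) ?_ t ht⟩
  · filter_upwards [hu, ae_restrict_of_ae_restrict_of_subset hsub hx.state_eq] with s h1 h2
    rwa [h1] at h2
  · filter_upwards [hu, ae_restrict_of_ae_restrict_of_subset hsub hl.adjoint_eq] with s h1 h2
    rwa [h1] at h2

theorem ae_sign_snd_of_control (hx : IsControlledTrajectory u₁ u₂ T x u)
    (hl : IsMultiplier u₁ u₂ T x u l₀ l) (hu : -u₁ < u₂) :
    ∀ᵐ s ∂(volume.restrict (Icc 0 T)), (u s = -u₁ → 0 ≤ (l s).2) ∧ (u s = u₂ → (l s).2 ≤ 0) := by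
  filter_upwards [hl.ae_control_eq hx] with s hs
  refine ⟨fun h => ?_, fun h => ?_⟩
  · by_contra! h'
    exact hu.ne (h.symm.trans (hs.2 h'))
  · by_contra! h'
    exact hu.ne' (h.symm.trans (hs.1 h'))

end IsMultiplier

namespace IsMultiplier

theorem fst_ne_zero (hl : IsMultiplier u₁ u₂ T x u l₀ l) {t : ℝ} (ht : t ∈ Icc 0 T)
    (h : (l t).2 = 0) : (l t).1 ≠ 0 := fun h1 => hl.ne_zero t ht (Prod.ext h1 h)

theorem add_mul_eq_zero (hx : IsControlledTrajectory u₁ u₂ T x u)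
    (hl : IsMultiplier u₁ u₂ T x u l₀ l) (hT : 0 < T) (hu : -u₁ ≤ u₂) {t : ℝ} (ht : t ∈ Icc 0 T)
    (h : (l t).2 = 0) : l₀ + (l t).1 * (x t).2 = 0 := by
  simpa [hamiltonian, velocity, h] using hl.max_hamiltonian_eq_zero hx hT hu ht

end IsMultiplier

/-! ### Switching times as zeros of l₂; the ratio at consecutive ones. -/

theorem ae_restrict_Ioo_inter {p q : ℝ → Prop} {a b c d : ℝ}
    (hp : ∀ᵐ s ∂(volume.restrict (Icc a b)), p s) (hq : ∀ᵐ s ∂(volume.restrict (Ioo c d)), q s) :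
    ∀ᵐ s ∂volume, s ∈ Icc a b → s ∈ Ioo c d → p s ∧ q s := by
  rw [ae_restrict_iff' measurableSet_Icc] at hp
  rw [ae_restrict_iff' measurableSet_Ioo] at hq
  filter_upwards [hp, hq] with s h1 h2 h3 h4 using ⟨h1 h3, h2 h4⟩

theorem frequently_nhdsLT_of_ae {p : ℝ → Prop} (hp : ∀ᵐ s ∂volume, p s) (t : ℝ) :
    ∃ᶠ s in 𝓝[<] t, p s := by
  refine fun h => ?_
  obtain ⟨a, ha, h⟩ := (mem_nhdsLT_iff_exists_Ioo_subset).1 h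
  have h0 : volume (Ioo a t) = 0 := measure_mono_null (fun s hs => by simpa using h hs) (ae_iff.1 hp)
  rw [Real.volume_Ioo, ENNReal.ofReal_eq_zero] at h0
  linarith [mem_Iio.1 ha]

theorem frequently_nhdsGT_of_ae {p : ℝ → Prop} (hp : ∀ᵐ s ∂volume, p s) (t : ℝ) :
    ∃ᶠ s in 𝓝[>] t, p s := by
  refine fun h => ?_
  obtain ⟨a, ha, h⟩ := (mem_nhdsGT_iff_exists_Ioo_subset).1 h
  have h0 : volume (Ioo t a) = 0 := measure_mono_null (fun s hs => by simpa using h hs) (ae_iff.1 hp)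
  rw [Real.volume_Ioo, ENNReal.ofReal_eq_zero] at h0
  linarith [mem_Ioi.1 ha]

/-- Were l₂ nonzero at `t`, it would keep its sign nearby and the maximum condition would force the
same bang value on both sides. -/
theorem IsSwitchingTime.snd_eq_zero (hx : IsControlledTrajectory u₁ u₂ T x u)
    (hl : IsMultiplier u₁ u₂ T x u l₀ l) (hu : -u₁ < u₂) {t : ℝ}
    (ht : IsSwitchingTime u₁ u₂ T u t) : (l t).2 = 0 := by
  obtain ⟨ht, a, b, hab, ε, hε, hleft, hright⟩ := ht
  have hmem : Icc 0 T ∈ 𝓝 t := Icc_mem_nhds ht.1 ht.2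
  have hc : ContinuousAt (fun s => (l s).2) t :=
    (hl.continuousOn hx.time_nonneg).snd.continuousAt hmem
  have hs := hl.ae_sign_snd_of_control hx hu
  have hLm : ∀ᶠ s in 𝓝[<] t, s ∈ Icc 0 T ∧ s ∈ Ioo (t - ε) t :=
    inter_mem (nhdsWithin_le_nhds hmem) (Ioo_mem_nhdsLT (by linarith))
  have hRm : ∀ᶠ s in 𝓝[>] t, s ∈ Icc 0 T ∧ s ∈ Ioo t (t + ε) :=
    inter_mem (nhdsWithin_le_nhds hmem) (Ioo_mem_nhdsGT (by linarith))
  have hL := (frequently_nhdsLT_of_ae (ae_restrict_Ioo_inter hs hleft) t).and_eventually hLm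
  have hR := (frequently_nhdsGT_of_ae (ae_restrict_Ioo_inter hs hright) t).and_eventually hRm
  by_contra h0
  rcases lt_or_gt_of_ne h0 with h0 | h0
  · have hneg : ∀ᶠ s in 𝓝 t, (l s).2 < 0 := hc.eventually_lt_const h0
    obtain ⟨s, ⟨hs1, hs2⟩, hs3⟩ := (hL.and_eventually (nhdsWithin_le_nhds hneg)).exists
    obtain ⟨r, ⟨hr1, hr2⟩, hr3⟩ := (hR.and_eventually (nhdsWithin_le_nhds hneg)).exists
    have h1 := hs1 hs2.1 hs2.2
    have h2 := hr1 hr2.1 hr2.2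
    rcases hab with ⟨rfl, rfl⟩ | ⟨rfl, rfl⟩
    · exact hs3.not_ge (h1.1.1 h1.2)
    · exact hr3.not_ge (h2.1.1 h2.2)
  · have hpos : ∀ᶠ s in 𝓝 t, 0 < (l s).2 := hc.eventually_const_lt h0
    obtain ⟨s, ⟨hs1, hs2⟩, hs3⟩ := (hL.and_eventually (nhdsWithin_le_nhds hpos)).exists
    obtain ⟨r, ⟨hr1, hr2⟩, hr3⟩ := (hR.and_eventually (nhdsWithin_le_nhds hpos)).exists
    have h1 := hs1 hs2.1 hs2.2
    have h2 := hr1 hr2.1 hr2.2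
    rcases hab with ⟨rfl, rfl⟩ | ⟨rfl, rfl⟩
    · exact hr3.not_ge (h2.1.2 h2.2)
    · exact hs3.not_ge (h1.1.2 h1.2)

/-- Since the adjoint vector never vanishes, l₂' = -l₁ ≠ 0 at a zero of l₂: the zero is simple and
l₂ changes sign. -/
theorem isSwitchingTime_of_snd_eq_zero (hx : IsControlledTrajectory u₁ u₂ T x u)
    (hl : IsMultiplier u₁ u₂ T x u l₀ l) {t : ℝ} (ht : t ∈ Ioo 0 T) (h0 : (l t).2 = 0) :
    IsSwitchingTime u₁ u₂ T u t := by
  have htI := Ioo_subset_Icc_self ht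
  have hd := hl.hasDerivWithinAt_snd hx.time_nonneg t htI
  have hctl := (ae_restrict_iff' measurableSet_Icc).1 (hl.ae_control_eq hx)
  have hmem : Icc 0 T ∈ 𝓝 t := Icc_mem_nhds ht.1 ht.2
  have main : ∀ a b : ℝ, (∀ᶠ s in 𝓝[<] t, (0 < (l s).2 → u s = -u₁) ∧ ((l s).2 < 0 → u s = u₂) →
      u s = a) → (∀ᶠ s in 𝓝[>] t, (0 < (l s).2 → u s = -u₁) ∧ ((l s).2 < 0 → u s = u₂) →
      u s = b) → ((a = -u₁ ∧ b = u₂) ∨ (a = u₂ ∧ b = -u₁)) → IsSwitchingTime u₁ u₂ T u t := by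
    intro a b h1 h2 hab
    obtain ⟨r, hr, h1⟩ := mem_nhdsLT_iff_exists_Ioo_subset.1
      (h1.and (nhdsWithin_le_nhds hmem))
    obtain ⟨r', hr', h2⟩ := mem_nhdsGT_iff_exists_Ioo_subset.1
      (h2.and (nhdsWithin_le_nhds hmem))
    have hr := mem_Iio.1 hr
    have hr' := mem_Ioi.1 hr'
    refine ⟨ht, a, b, hab, min (t - r) (r' - t), lt_min (by linarith) (by linarith), ?_, ?_⟩
    · rw [ae_restrict_iff' measurableSet_Ioo]
      filter_upwards [hctl] with s hs hm
      have := h1 (show s ∈ Ioo r t from ⟨by linarith [hm.1, min_le_left (t - r) (r' - t)], hm.2⟩)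
      exact this.1 (hs this.2)
    · rw [ae_restrict_iff' measurableSet_Ioo]
      filter_upwards [hctl] with s hs hm
      have := h2 (show s ∈ Ioo t r' from ⟨hm.1, by linarith [hm.2, min_le_right (t - r) (r' - t)]⟩)
      exact this.1 (hs this.2)
  rcases lt_or_gt_of_ne (hl.fst_ne_zero htI h0) with h1 | h1
  · refine main u₂ (-u₁) ?_ ?_ (Or.inr ⟨rfl, rfl⟩)
    · filter_upwards [eventually_neg_nhdsLT_of_hasDerivWithinAt ⟨ht.1, htI.2⟩ hd
        (Or.inr ⟨h0, by linarith⟩)] with s hs h using h.2 hs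
    · filter_upwards [eventually_pos_nhdsGT_of_hasDerivWithinAt ⟨htI.1, ht.2⟩ hd
        (Or.inr ⟨h0, by linarith⟩)] with s hs h using h.1 hs
  · refine main (-u₁) u₂ ?_ ?_ (Or.inl ⟨rfl, rfl⟩)
    · filter_upwards [eventually_pos_nhdsLT_of_hasDerivWithinAt ⟨ht.1, htI.2⟩ hd
        (Or.inr ⟨h0, by linarith⟩)] with s hs h using h.1 hs
    · filter_upwards [eventually_neg_nhdsGT_of_hasDerivWithinAt ⟨htI.1, ht.2⟩ hd
        (Or.inr ⟨h0, by linarith⟩)] with s hs h using h.2 hs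

/-- The first integral and the alternation of the sign of `l₁` at consecutive switching times. -/
theorem AreConsecutiveSwitchingTimes.fst_mul_fst_eq_neg (hx : IsControlledTrajectory u₁ u₂ T x u)
    (hl : IsMultiplier u₁ u₂ T x u l₀ l) (hu : -u₁ < u₂) {t t' : ℝ}
    (h : AreConsecutiveSwitchingTimes u₁ u₂ T u t t') :
    (l t').1 * (x t').1 = -((l t).1 * (x t).1) := by
  obtain ⟨ht, ht', hlt, hno⟩ := h
  have htI := Ioo_subset_Icc_self ht.1
  have htI' := Ioo_subset_Icc_self ht'.1
  have h0 := ht.snd_eq_zero hx hl hu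
  have h0' := ht'.snd_eq_zero hx hl hu
  have hd := hl.hasDerivWithinAt_snd hx.time_nonneg t htI
  have hd' := hl.hasDerivWithinAt_snd hx.time_nonneg t' htI'
  have hp := hx.state_pos t htI
  have hp' := hx.state_pos t' htI'
  have hsq : ((l t').1 * (x t').1) ^ 2 = ((l t).1 * (x t).1) ^ 2 := by
    have := (hl.firstIntegral_eq hx htI').trans (hl.firstIntegral_eq hx htI).symm
    simpa [h0, h0'] using this
  rcases sq_eq_sq_iff_eq_or_eq_neg.1 hsq with heq | heq
  -- If l₁ had the same sign at both times, l₂ would have opposite signs just after `t` and just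
  -- before `t'`; a zero in between would be a further switching time.
  · exfalso
    have hcont : ContinuousOn (fun s => (l s).2) (Icc 0 T) := (hl.continuousOn hx.time_nonneg).snd
    have hzero : ∀ r ∈ Ioo t t', ∀ r' ∈ Ioo t t', r < r' → (l r).2 * (l r').2 < 0 → False := by
      intro r hr r' hr' hrr hneg
      have hsub : Icc r r' ⊆ Icc 0 T := Icc_subset_Icc (htI.1.trans hr.1.le) (hr'.2.le.trans htI'.2)
      have hz : ∃ s ∈ Icc r r', (l s).2 = 0 := by
        rcases mul_neg_iff.1 hneg with h | h
        · exact intermediate_value_Icc' hrr.le (hcont.mono hsub) ⟨h.2.le, h.1.le⟩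
        · exact intermediate_value_Icc hrr.le (hcont.mono hsub) ⟨h.1.le, h.2.le⟩
      obtain ⟨s, hs, hs0⟩ := hz
      have hs' : s ∈ Ioo t t' := ⟨hr.1.trans_le hs.1, hs.2.trans_lt hr'.2⟩
      exact hno s hs' (isSwitchingTime_of_snd_eq_zero hx hl
        ⟨ht.1.1.trans hs'.1, hs'.2.trans ht'.1.2⟩ hs0)
    have hm1 : Ioo t ((t + t') / 2) ∈ 𝓝[>] t := Ioo_mem_nhdsGT (by linarith)
    have hm2 : Ioo ((t + t') / 2) t' ∈ 𝓝[<] t' := Ioo_mem_nhdsLT (by linarith)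
    rcases lt_or_gt_of_ne (hl.fst_ne_zero htI h0) with h1 | h1
    · have h1' : (l t').1 < 0 := by
        have : (l t').1 * (x t').1 < 0 := heq ▸ mul_neg_of_neg_of_pos h1 hp
        exact neg_of_mul_neg_left this hp'.le
      obtain ⟨r, hr, hrm⟩ := ((eventually_pos_nhdsGT_of_hasDerivWithinAt ⟨htI.1, ht.1.2⟩ hd
        (Or.inr ⟨h0, by linarith⟩)).and hm1).exists
      obtain ⟨r', hr', hrm'⟩ := ((eventually_neg_nhdsLT_of_hasDerivWithinAt ⟨ht'.1.1, htI'.2⟩ hd'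
        (Or.inr ⟨h0', by linarith⟩)).and hm2).exists
      exact hzero r ⟨hrm.1, by linarith [hrm.2]⟩ r' ⟨by linarith [hrm'.1], hrm'.2⟩
        (hrm.2.trans hrm'.1) (mul_neg_of_pos_of_neg hr hr')
    · have h1' : 0 < (l t').1 := by
        have : 0 < (l t').1 * (x t').1 := heq ▸ mul_pos h1 hp
        exact pos_of_mul_pos_left this hp'.le
      obtain ⟨r, hr, hrm⟩ := ((eventually_neg_nhdsGT_of_hasDerivWithinAt ⟨htI.1, ht.1.2⟩ hd
        (Or.inr ⟨h0, by linarith⟩)).and hm1).exists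
      obtain ⟨r', hr', hrm'⟩ := ((eventually_pos_nhdsLT_of_hasDerivWithinAt ⟨ht'.1.1, htI'.2⟩ hd'
        (Or.inr ⟨h0', by linarith⟩)).and hm2).exists
      exact hzero r ⟨hrm.1, by linarith [hrm.2]⟩ r' ⟨by linarith [hrm'.1], hrm'.2⟩
        (hrm.2.trans hrm'.1) (mul_neg_of_neg_of_pos hr hr')
  · exact heq

theorem AreConsecutiveSwitchingTimes.ratio_eq_neg (hx : IsControlledTrajectory u₁ u₂ T x u)
    (hl : IsMultiplier u₁ u₂ T x u l₀ l) (hu : -u₁ < u₂) {t t' : ℝ}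
    (h : AreConsecutiveSwitchingTimes u₁ u₂ T u t t') :
    (x t').2 / (x t').1 = -((x t).2 / (x t).1) := by
  have hT : 0 < T := h.1.1.1.trans h.1.1.2
  have htI := Ioo_subset_Icc_self h.1.1
  have htI' := Ioo_subset_Icc_self h.2.1.1
  have h0 := h.1.snd_eq_zero hx hl hu
  have h0' := h.2.1.snd_eq_zero hx hl hu
  have h1 := hl.add_mul_eq_zero hx hT hu.le htI h0
  have h1' := hl.add_mul_eq_zero hx hT hu.le htI' h0'
  have h2 := h.fst_mul_fst_eq_neg hx hl hu
  have hp := hx.state_pos t htI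
  have hp' := hx.state_pos t' htI'
  rw [div_eq_iff hp'.ne', neg_mul, div_mul_eq_mul_div, ← neg_div, eq_div_iff hp.ne']
  have h3 := hl.fst_ne_zero htI h0
  -- After multiplication by l₁(t) l₁(t') ≠ 0 the claim follows from l₁x₂ having the same value, and
  -- l₁x₁ opposite values, at the two times.
  refine mul_left_cancel₀ (hl.fst_ne_zero htI' h0') (mul_left_cancel₀ h3 ?_)
  linear_combination (l t).1 * (x t).1 * (h1' - h1) + (l t).1 * (x t).2 * h2

/-! ### Abnormal extremals and the nonvanishing of the ratio. -/

/-- An abnormal extremal that starts and ends on the `x₁`-axis satisfies `l₂ ≤ 0`. -/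
theorem IsMultiplier.snd_nonpos_of_abnormal (hx : IsControlledTrajectory u₁ u₂ T x u)
    (hl : IsMultiplier u₁ u₂ T x u 0 l) (hT : 0 < T) (hu₁ : 0 < u₁) (hu₂ : 0 < u₂) (h0 : (x 0).2 = 0)
    (hT0 : (x T).2 = 0) {s : ℝ} (hs : s ∈ Icc 0 T) : (l s).2 ≤ 0 := by
  by_contra! hpos
  have hu : -u₁ ≤ u₂ := by linarith
  -- On the axis with l₀ = 0, H at the control -u₁ is l₂ times a positive number, and H ≤ 0.
  have hax : ∀ r ∈ Icc 0 T, (x r).2 = 0 → (l r).2 ≤ 0 := by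
    intro r hr h
    by_contra! hr2
    have h1 := hl.max_hamiltonian_eq_zero hx hT hu hr
    have h2 := h1 ▸ le_max_left (hamiltonian 0 (l r) (x r) (-u₁)) _
    have hp := hx.state_pos r hr
    simp only [hamiltonian, velocity, h, mul_zero, zero_add, neg_neg] at h2
    have : 0 < (l r).2 * (u₁ * (x r).1 + 1 / (x r).1 ^ 3) := by positivity
    linarith
  have hcont : ContinuousOn (fun s => (l s).2) (Icc 0 T) := (hl.continuousOn hx.time_nonneg).snd
  have hK : ∀ c d, Icc c d ⊆ Icc 0 T → IsCompact (Icc c d ∩ {r | (l r).2 ≤ 0}) := fun c d hcd =>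
    isCompact_Icc.of_isClosed_subset
      ((hcont.mono hcd).preimage_isClosed_of_isClosed isClosed_Icc isClosed_Iic) inter_subset_left
  -- `a` and `b` bound the maximal interval around `s` on which l₂ > 0; they exist because l₂ ≤ 0 at
  -- 0 and at `T`.
  obtain ⟨a, ⟨ha, ha0⟩, hamax⟩ := (hK 0 s (Icc_subset_Icc le_rfl hs.2)).exists_isGreatest
    ⟨0, ⟨le_rfl, hs.1⟩, hax 0 ⟨le_rfl, hT.le⟩ h0⟩
  obtain ⟨b, ⟨hb, hb0⟩, hbmin⟩ := (hK s T (Icc_subset_Icc hs.1 le_rfl)).exists_isLeast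
    ⟨T, ⟨hs.2, le_rfl⟩, hax T ⟨hT.le, le_rfl⟩ hT0⟩
  have haI : a ∈ Icc 0 T := ⟨ha.1, ha.2.trans hs.2⟩
  have hbI : b ∈ Icc 0 T := ⟨hs.1.trans hb.1, hb.2⟩
  have has : a < s := lt_of_le_of_ne ha.2 (by rintro rfl; exact hpos.not_ge ha0)
  have hsb : s < b := lt_of_le_of_ne hb.1 (by rintro rfl; exact hpos.not_ge hb0)
  have hab := has.trans hsb
  have hIoo : ∀ r ∈ Ioo a b, 0 < (l r).2 := by
    intro r hr
    by_contra! h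
    rcases le_total r s with h1 | h1
    · exact hr.1.not_ge (hamax ⟨⟨haI.1.trans hr.1.le, h1⟩, h⟩)
    · exact hr.2.not_ge (hbmin ⟨⟨h1, hr.2.le.trans hbI.2⟩, h⟩)
  have hcl : ∀ r ∈ Icc a b, 0 ≤ (l r).2 := by
    intro r hr
    rw [← closure_Ioo hab.ne] at hr
    have hsub : closure (Ioo a b) ⊆ Icc 0 T := by
      rw [closure_Ioo hab.ne]; exact Icc_subset_Icc haI.1 hbI.2
    exact ContinuousWithinAt.closure_le hr continuousWithinAt_const
      ((hcont.mono hsub r hr).mono subset_closure) fun y hy => (hIoo y hy).le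
  have hend : ∀ r ∈ Icc a b, (l r).2 ≤ 0 → (x r).2 = 0 := by
    intro r hr h
    have hrI : r ∈ Icc 0 T := ⟨haI.1.trans hr.1, hr.2.trans hbI.2⟩
    have h2 := le_antisymm h (hcl r hr)
    have := hl.add_mul_eq_zero hx hT hu hrI h2
    rw [zero_add] at this
    exact (mul_eq_zero.1 this).resolve_left (hl.fst_ne_zero hrI h2)
  have hd : ∀ r ∈ Icc a b, HasDerivWithinAt (fun r => (x r).2) (u₁ * (x r).1 + 1 / (x r).1 ^ 3)
      (Icc a b) r := fun r hr => by
    have := (hl.hasDerivWithinAt_of_isBangControl hx haI.1 hab.le hbI.2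
      (Or.inl ⟨rfl, hIoo⟩) hr).1
    have h2 : HasDerivWithinAt (fun r => (x r).2) (velocity (x r) (-u₁)).2 (Icc a b) r := this.snd
    simpa [velocity] using h2
  -- Under the control -u₁ both terms of x₂' are positive, so x₂ cannot vanish at both `a` and `b`.
  have hmono : StrictMonoOn (fun r => (x r).2) (Icc a b) := by
    refine strictMonoOn_of_hasDerivWithinAt_pos (convex_Icc a b)
      (fun r hr => (hd r hr).continuousWithinAt)
      (fun r hr => (hd r (interior_subset hr)).mono interior_subset) fun r hr => ?_
    have hr := interior_subset hr
    have := hx.state_pos r ⟨haI.1.trans hr.1, hr.2.trans hbI.2⟩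
    positivity
  have := hmono ⟨le_rfl, hab.le⟩ ⟨hab.le, le_rfl⟩ hab
  simp only [hend a ⟨le_rfl, hab.le⟩ ha0, hend b ⟨hab.le, le_rfl⟩ hb0, lt_irrefl] at this

theorem IsSwitchingTime.state_snd_ne_zero (hx : IsControlledTrajectory u₁ u₂ T x u)
    (hl : IsMultiplier u₁ u₂ T x u l₀ l) (hu₁ : 0 < u₁) (hu₂ : 0 < u₂) (h0 : (x 0).2 = 0)
    (hT0 : (x T).2 = 0) {t : ℝ} (ht : IsSwitchingTime u₁ u₂ T u t) : (x t).2 ≠ 0 := by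
  intro hxt
  have hu : -u₁ < u₂ := by linarith
  have htI := Ioo_subset_Icc_self ht.1
  have hz := ht.snd_eq_zero hx hl hu
  have hl0 : l₀ = 0 := by
    simpa [hxt] using hl.add_mul_eq_zero hx (ht.1.1.trans ht.1.2) hu.le htI hz
  subst hl0
  have hd := hl.hasDerivWithinAt_snd hx.time_nonneg t htI
  have hmem : Icc 0 T ∈ 𝓝 t := Icc_mem_nhds ht.1.1 ht.1.2
  rcases lt_or_gt_of_ne (hl.fst_ne_zero htI hz) with h1 | h1
  · obtain ⟨r, hr, hrm⟩ := ((eventually_pos_nhdsGT_of_hasDerivWithinAt ⟨htI.1, ht.1.2⟩ hd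
      (Or.inr ⟨hz, by linarith⟩)).and (nhdsWithin_le_nhds hmem)).exists
    exact hr.not_ge (hl.snd_nonpos_of_abnormal hx (ht.1.1.trans ht.1.2) hu₁ hu₂ h0 hT0 hrm)
  · obtain ⟨r, hr, hrm⟩ := ((eventually_pos_nhdsLT_of_hasDerivWithinAt ⟨ht.1.1, htI.2⟩ hd
      (Or.inr ⟨hz, by linarith⟩)).and (nhdsWithin_le_nhds hmem)).exists
    exact hr.not_ge (hl.snd_nonpos_of_abnormal hx (ht.1.1.trans ht.1.2) hu₁ hu₂ h0 hT0 hrm)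

end AtomCooling

/-! ### Time reversal, uniqueness of the bang flow, and asymmetry. -/

theorem HasDerivWithinAt.comp_const_sub_Icc {E : Type*} [NormedAddCommGroup E] [NormedSpace ℝ E]
    {f : ℝ → E} {f' : E} {a b s : ℝ} (c : ℝ)
    (hf : HasDerivWithinAt f f' (Icc (c - b) (c - a)) (c - s)) :
    HasDerivWithinAt (fun r => f (c - r)) (-f') (Icc a b) s := by
  have := HasDerivWithinAt.scomp s (t' := Icc (c - b) (c - a)) (h := fun r => c - r) (h' := -1)
    (s := Icc a b) hf ((hasDerivWithinAt_id s _).const_sub c)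
    (fun r hr => ⟨by linarith [hr.2], by linarith [hr.1]⟩)
  simpa using! this

theorem HasDerivWithinAt.comp_const_add_Icc {E : Type*} [NormedAddCommGroup E] [NormedSpace ℝ E]
    {f : ℝ → E} {f' : E} {a b s : ℝ} (c : ℝ)
    (hf : HasDerivWithinAt f f' (Icc (c + a) (c + b)) (c + s)) :
    HasDerivWithinAt (fun r => f (c + r)) f' (Icc a b) s := by
  have := HasDerivWithinAt.scomp s (t' := Icc (c + a) (c + b)) (h := fun r => c + r) (h' := 1)
    (s := Icc a b) hf ((hasDerivWithinAt_id s _).const_add c)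
    (fun r hr => ⟨by linarith [hr.1], by linarith [hr.2]⟩)
  simpa using! this

namespace AtomCooling

variable {u₁ u₂ T τ l₀ : ℝ} {x l y m : ℝ → ℝ × ℝ} {u : ℝ → ℝ}

/-- State and adjoint variables on `[0, τ]` that follow the Hamiltonian system with the control
prescribed by the sign of `l₂`. -/
structure IsBangFlow (u₁ u₂ τ : ℝ) (x l : ℝ → ℝ × ℝ) : Prop where
  state_cont : ContinuousOn x (Icc 0 τ)
  adjoint_cont : ContinuousOn l (Icc 0 τ)
  state_pos : ∀ t ∈ Icc 0 τ, 0 < (x t).1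
  adjoint_ne_zero : ∀ t ∈ Icc 0 τ, l t ≠ 0
  hasDeriv_snd : ∀ t ∈ Icc 0 τ, HasDerivWithinAt (fun s => (l s).2) (-(l t).1) (Icc 0 τ) t
  hasDeriv : ∀ a b v : ℝ, 0 ≤ a → a ≤ b → b ≤ τ → IsBangControl u₁ u₂ l a b v → ∀ t ∈ Icc a b,
    HasDerivWithinAt x (velocity (x t) v) (Icc a b) t ∧
      HasDerivWithinAt l (adjointVelocity (l t) (x t) v) (Icc a b) t

theorem IsMultiplier.isBangFlow (hx : IsControlledTrajectory u₁ u₂ T x u)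
    (hl : IsMultiplier u₁ u₂ T x u l₀ l) : IsBangFlow u₁ u₂ T x l where
  state_cont := hx.continuousOn
  adjoint_cont := hl.continuousOn hx.time_nonneg
  state_pos := hx.state_pos
  adjoint_ne_zero := hl.ne_zero
  hasDeriv_snd := hl.hasDerivWithinAt_snd hx.time_nonneg
  hasDeriv _ _ _ ha hab hb hv _ ht := hl.hasDerivWithinAt_of_isBangControl hx ha hab hb hv ht

namespace IsBangFlow

theorem comp_const_add (h : IsBangFlow u₁ u₂ T x l) {c : ℝ} (hc : 0 ≤ c) (hτ : c + τ ≤ T) :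
    IsBangFlow u₁ u₂ τ (fun s => x (c + s)) (fun s => l (c + s)) := by
  have hm : MapsTo (fun s => c + s) (Icc 0 τ) (Icc 0 T) := fun s hs =>
    ⟨by linarith [hs.1], by linarith [hs.2]⟩
  have hcont : ContinuousOn (fun s => c + s) (Icc 0 τ) := by fun_prop
  refine ⟨h.state_cont.comp hcont hm, h.adjoint_cont.comp hcont hm,
    fun t ht => h.state_pos _ (hm ht), fun t ht => h.adjoint_ne_zero _ (hm ht), fun t ht => ?_, ?_⟩
  · exact HasDerivWithinAt.comp_const_add_Icc (f := fun s => (l s).2) c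
      ((h.hasDeriv_snd _ (hm ht)).mono (Icc_subset_Icc (by linarith) hτ))
  · intro a b v ha hab hb hv t ht
    have hv' : IsBangControl u₁ u₂ l (c + a) (c + b) v := by
      refine hv.imp (And.imp_right fun H s hs => ?_) (And.imp_right fun H s hs => ?_) <;>
      · have := H (s - c) ⟨by linarith [hs.1], by linarith [hs.2]⟩
        simpa using this
    have := h.hasDeriv (c + a) (c + b) v (by linarith) (by linarith) (by linarith) hv' (c + t)
      ⟨by linarith [ht.1], by linarith [ht.2]⟩
    exact ⟨this.1.comp_const_add_Icc c, this.2.comp_const_add_Icc c⟩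

/-- Time reversal combined with the reflection in the `x₁`-axis. -/
theorem comp_const_sub (h : IsBangFlow u₁ u₂ T x l) {c : ℝ} (hc : c ≤ T) (hτ : τ ≤ c) :
    IsBangFlow u₁ u₂ τ (fun s => ((x (c - s)).1, -(x (c - s)).2))
      (fun s => (-(l (c - s)).1, (l (c - s)).2)) := by
  have hm : MapsTo (fun s => c - s) (Icc 0 τ) (Icc 0 T) := fun s hs =>
    ⟨by linarith [hs.2], by linarith [hs.1]⟩
  have hcont : ContinuousOn (fun s => c - s) (Icc 0 τ) := by fun_prop
  have hxc := h.state_cont.comp hcont hm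
  have hlc := h.adjoint_cont.comp hcont hm
  refine ⟨hxc.fst.prodMk hxc.snd.neg, hlc.fst.neg.prodMk hlc.snd,
    fun t ht => h.state_pos _ (hm ht), fun t ht h0 => h.adjoint_ne_zero _ (hm ht) ?_,
    fun t ht => ?_, ?_⟩
  · simp only [Prod.mk_eq_zero, neg_eq_zero] at h0
    exact Prod.ext h0.1 h0.2
  · exact HasDerivWithinAt.comp_const_sub_Icc (f := fun s => (l s).2) c
      ((h.hasDeriv_snd _ (hm ht)).mono (Icc_subset_Icc (by linarith) (by linarith)))
  · intro a b v ha hab hb hv t ht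
    have hv' : IsBangControl u₁ u₂ l (c - b) (c - a) v := by
      refine hv.imp (And.imp_right fun H s hs => ?_) (And.imp_right fun H s hs => ?_) <;>
      · have := H (c - s) ⟨by linarith [hs.2], by linarith [hs.1]⟩
        simpa using this
    have := h.hasDeriv (c - b) (c - a) v (by linarith) (by linarith) (by linarith) hv' (c - t)
      ⟨by linarith [ht.2], by linarith [ht.1]⟩
    have h1 := this.1.comp_const_sub_Icc c
    have h2 := this.2.comp_const_sub_Icc c
    have hx₁ : HasDerivWithinAt (fun r => (x (c - r)).1) (-(velocity (x (c - t)) v)).1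
      (Icc a b) t := h1.fst
    have hx₂ : HasDerivWithinAt (fun r => (x (c - r)).2) (-(velocity (x (c - t)) v)).2
      (Icc a b) t := h1.snd
    have hl₁ : HasDerivWithinAt (fun r => (l (c - r)).1)
      (-(adjointVelocity (l (c - t)) (x (c - t)) v)).1 (Icc a b) t := h2.fst
    have hl₂ : HasDerivWithinAt (fun r => (l (c - r)).2)
      (-(adjointVelocity (l (c - t)) (x (c - t)) v)).2 (Icc a b) t := h2.snd
    refine ⟨(hx₁.prodMk hx₂.fun_neg).congr_deriv ?_, (hl₁.fun_neg.prodMk hl₂).congr_deriv ?_⟩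
    · simp [velocity]
    · simp [adjointVelocity]

theorem eventually_sign_snd (h : IsBangFlow u₁ u₂ τ x l) {t : ℝ} (ht : t ∈ Ico 0 τ) :
    (0 < (l t).2 ∨ (l t).2 = 0 ∧ 0 < -(l t).1 → ∀ᶠ s in 𝓝[>] t, 0 < (l s).2) ∧
    ((l t).2 < 0 ∨ (l t).2 = 0 ∧ -(l t).1 < 0 → ∀ᶠ s in 𝓝[>] t, (l s).2 < 0) :=
  ⟨eventually_pos_nhdsGT_of_hasDerivWithinAt ht (h.hasDeriv_snd t (Ico_subset_Icc_self ht)),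
    eventually_neg_nhdsGT_of_hasDerivWithinAt ht (h.hasDeriv_snd t (Ico_subset_Icc_self ht))⟩

/-- The Hamiltonian vector field for the constant control `v`. -/
noncomputable def vectorField (v : ℝ) (z : (ℝ × ℝ) × (ℝ × ℝ)) : (ℝ × ℝ) × (ℝ × ℝ) :=
  (velocity z.1 v, adjointVelocity z.2 z.1 v)

theorem contDiffAt_vectorField (v : ℝ) {z : (ℝ × ℝ) × (ℝ × ℝ)} (hz : 0 < z.1.1) :
    ContDiffAt ℝ 1 (vectorField v) z := by
  unfold vectorField velocity adjointVelocity
  have h3 : z.1.1 ^ 3 ≠ 0 := by positivity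
  have h4 : z.1.1 ^ 4 ≠ 0 := by positivity
  fun_prop (disch := assumption)

/-- The feedback jumps at l₂ = 0, but the sign of l₂ just after `t` is determined by the value of
the adjoint at `t`: it is that of l₂, or of -l₁ when l₂ = 0. Both flows thus follow one constant
control for a while, and that vector field is locally Lipschitz. -/
theorem eventually_eq (hx : IsBangFlow u₁ u₂ τ x l) (hy : IsBangFlow u₁ u₂ τ y m) {t : ℝ}
    (ht : t ∈ Ico 0 τ) (hxy : x t = y t) (hlm : l t = m t) :
    ∀ᶠ s in 𝓝[>] t, x s = y s ∧ l s = m s := by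
  have htI := Ico_subset_Icc_self ht
  obtain ⟨v, hv⟩ : ∃ v, (v = -u₁ ∧ ∀ᶠ s in 𝓝[>] t, 0 < (l s).2 ∧ 0 < (m s).2) ∨
      (v = u₂ ∧ ∀ᶠ s in 𝓝[>] t, (l s).2 < 0 ∧ (m s).2 < 0) := by
    have h1 := hx.eventually_sign_snd ht
    have h2 := hy.eventually_sign_snd ht
    rw [← hlm] at h2
    have hdich : (0 < (l t).2 ∨ (l t).2 = 0 ∧ 0 < -(l t).1) ∨
        ((l t).2 < 0 ∨ (l t).2 = 0 ∧ -(l t).1 < 0) := by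
      have hne := hx.adjoint_ne_zero t htI
      rcases lt_trichotomy (l t).2 0 with h | h | h
      · exact Or.inr (Or.inl h)
      · rcases lt_trichotomy (-(l t).1) 0 with h' | h' | h'
        · exact Or.inr (Or.inr ⟨h, h'⟩)
        · exact absurd (Prod.ext (neg_eq_zero.1 h') h) hne
        · exact Or.inl (Or.inr ⟨h, h'⟩)
      · exact Or.inl (Or.inl h)
    rcases hdich with h | h
    · exact ⟨-u₁, Or.inl ⟨rfl, (h1.1 h).and (h2.1 h)⟩⟩
    · exact ⟨u₂, Or.inr ⟨rfl, (h1.2 h).and (h2.2 h)⟩⟩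
  obtain ⟨K, N, hN, hK⟩ := (contDiffAt_vectorField v (z := (x t, l t))
    (hx.state_pos t htI)).exists_lipschitzOnWith
  have hle : 𝓝[>] t ≤ 𝓝[Icc 0 τ] t := by
    rw [← nhdsWithin_Ioc_eq_nhdsGT ht.2]
    exact nhdsWithin_mono _ fun s hs => ⟨ht.1.trans hs.1.le, hs.2⟩
  have hxN : ∀ᶠ s in 𝓝[>] t, (x s, l s) ∈ N :=
    hle ((hx.state_cont.prodMk hx.adjoint_cont t htI) hN)
  have hyN : ∀ᶠ s in 𝓝[>] t, (y s, m s) ∈ N :=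
    hle ((hy.state_cont.prodMk hy.adjoint_cont t htI) (by simpa only [← hxy, ← hlm] using hN))
  have hbang : ∀ᶠ b in 𝓝[>] t, IsBangControl u₁ u₂ l t b v ∧ IsBangControl u₁ u₂ m t b v := by
    rcases hv with ⟨hv, h⟩ | ⟨hv, h⟩ <;>
    · obtain ⟨c, hc, hsub⟩ := mem_nhdsGT_iff_exists_Ioc_subset.1 h
      filter_upwards [Ioc_mem_nhdsGT hc] with b hb
      have hs : ∀ s ∈ Ioo t b, s ∈ Ioc t c := fun s hs => ⟨hs.1, hs.2.le.trans hb.2⟩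
      first
      | exact ⟨Or.inl ⟨hv, fun s h => (hsub (hs s h)).1⟩, Or.inl ⟨hv, fun s h => (hsub (hs s h)).2⟩⟩
      | exact ⟨Or.inr ⟨hv, fun s h => (hsub (hs s h)).1⟩, Or.inr ⟨hv, fun s h => (hsub (hs s h)).2⟩⟩
  obtain ⟨b, hb, hsub⟩ := mem_nhdsGT_iff_exists_Ioc_subset.1
    (hbang.and (hxN.and (hyN.and (Ioc_mem_nhdsGT ht.2))))
  have hb : t < b := hb
  obtain ⟨hbang, -, -, -, hbτ⟩ := hsub ⟨hb, le_rfl⟩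
  have hIcc : Icc t b ⊆ Icc 0 τ := Icc_subset_Icc ht.1 hbτ
  have hIci : ∀ s ∈ Ico t b, Icc t b ∈ 𝓝[≥] s := fun s hs =>
    mem_of_superset (Icc_mem_nhdsGE hs.2) (Icc_subset_Icc hs.1 le_rfl)
  have hmemN : ∀ s ∈ Ico t b, (x s, l s) ∈ N ∧ (y s, m s) ∈ N := by
    intro s hs
    rcases hs.1.eq_or_lt with rfl | h
    · exact ⟨mem_of_mem_nhds hN, by rw [← hxy, ← hlm]; exact mem_of_mem_nhds hN⟩
    · exact ⟨(hsub ⟨h, hs.2.le⟩).2.1, (hsub ⟨h, hs.2.le⟩).2.2.1⟩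
  have hEq := ODE_solution_unique_of_mem_Icc_right (v := fun _ => vectorField v) (s := fun _ => N)
    (f := fun s => (x s, l s)) (g := fun s => (y s, m s)) (a := t) (b := b) (K := K)
    (fun _ _ => hK) ((hx.state_cont.prodMk hx.adjoint_cont).mono hIcc)
    (fun s hs => by
      have := hx.hasDeriv t b v ht.1 hb.le hbτ hbang.1 s (Ico_subset_Icc_self hs)
      exact (this.1.prodMk this.2).mono_of_mem_nhdsWithin (hIci s hs))
    (fun s hs => (hmemN s hs).1) ((hy.state_cont.prodMk hy.adjoint_cont).mono hIcc)
    (fun s hs => by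
      have := hy.hasDeriv t b v ht.1 hb.le hbτ hbang.2 s (Ico_subset_Icc_self hs)
      exact (this.1.prodMk this.2).mono_of_mem_nhdsWithin (hIci s hs))
    (fun s hs => (hmemN s hs).2) (by simp only [hxy, hlm])
  filter_upwards [Ioc_mem_nhdsGT hb] with s hs
  have := hEq (Ioc_subset_Icc_self hs)
  exact ⟨congrArg Prod.fst this, congrArg Prod.snd this⟩

theorem eqOn (hx : IsBangFlow u₁ u₂ τ x l) (hy : IsBangFlow u₁ u₂ τ y m) (hxy : x 0 = y 0)
    (hlm : l 0 = m 0) : EqOn x y (Icc 0 τ) := by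
  have hclosed : IsClosed ({s | (x s, l s) = (y s, m s)} ∩ Icc 0 τ) := by
    have hp := (hx.state_cont.prodMk hx.adjoint_cont).prodMk
      (hy.state_cont.prodMk hy.adjoint_cont)
    rw [inter_comm]
    exact hp.preimage_isClosed_of_isClosed isClosed_Icc isClosed_diagonal
  have hsub := hclosed.Icc_subset_of_forall_mem_nhdsWithin (by simp [hxy, hlm]) fun s hs => by
    have := (Prod.mk.injEq _ _ _ _).mp hs.1
    filter_upwards [hx.eventually_eq hy hs.2 this.1 this.2] with r hr
    exact Prod.ext hr.1 hr.2
  exact fun s hs => congrArg Prod.fst (hsub hs)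

end IsBangFlow

theorem IsTimeOptimal.not_symmetric {γ : ℝ} (hopt : IsTimeOptimal u₁ u₂ γ T x u)
    (hl : IsMultiplier u₁ u₂ T x u l₀ l) (hu : -u₁ < u₂) {t t' : ℝ}
    (h : AreConsecutiveSwitchingTimes u₁ u₂ T u t t') : x t' ≠ ((x t).1, -(x t).2) := by
  intro hsym
  obtain ⟨⟨hx, hx0, hxT⟩, hmin⟩ := hopt
  have ht := h.1.1
  have ht' := h.2.1.1
  have hlt := h.2.2.1
  have h0 := h.1.snd_eq_zero hx hl hu
  have h0' := h.2.1.snd_eq_zero hx hl hu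
  have h1 := h.fst_mul_fst_eq_neg hx hl hu
  -- Mirror-image states share x₁, so the sign reversal of l₁x₁ passes to l₁; the reflected adjoint
  -- at `t` is then the adjoint at `t'`.
  have hl1 : (l t').1 = -(l t).1 := by
    rw [hsym, ← neg_mul] at h1
    exact mul_right_cancel₀ (hx.state_pos t (Ioo_subset_Icc_self ht)).ne' h1
  have hflow := hl.isBangFlow hx
  have key : ∀ s, 0 ≤ s → s ≤ t → t' + s ≤ T →
      x (t' + s) = ((x (t - s)).1, -(x (t - s)).2) := fun s hs hst hsT =>
    (hflow.comp_const_add (c := t') ht'.1.le hsT).eqOn (hflow.comp_const_sub (c := t) ht.2.le hst)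
      (by simpa using hsym) (by simpa [h0] using Prod.ext hl1 h0') ⟨hs, le_rfl⟩
  -- Either the mirrored arc reaches the image of time 0 by `T`, and the loop up to `t' + t` can be
  -- dropped, or `T` comes first, and its mirror time `t - (T - t')` already meets (γ, 0).
  rcases le_total (t' + t) T with hle | hle
  · have hk := key t ht.1.le le_rfl hle
    have := hmin (T - (t' + t)) _ _ ⟨hx.restrict_const_add (a := t' + t) (b := T - (t' + t))
      (by linarith [ht.1, ht'.1]) (by linarith) (by linarith), by simpa [hx0] using hk,
      by simpa using hxT⟩
    linarith [ht.1, ht'.1]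
  · have hk := key (T - t') (by linarith [ht'.2]) (by linarith) (by linarith)
    have hk' : x (t - (T - t')) = (γ, 0) := by
      rw [show t' + (T - t') = T by ring, hxT, Prod.ext_iff] at hk
      exact Prod.ext hk.1.symm (by simpa using hk.2)
    have := hmin (t - (T - t')) _ _ ⟨hx.restrict_const_add (a := 0) (b := t - (T - t'))
      le_rfl (by linarith) (by linarith [ht'.2, ht.2]), by simpa using hx0, by simpa using hk'⟩
    linarith [ht'.2, ht.2]

end AtomCooling

end

theorem mainTheorem7 (u₁ u₂ : ℝ) (hu₁ : 1 ≤ u₁) (hu₂ : 1 ≤ u₂)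
    (T : ℝ) (x : ℝ → ℝ × ℝ) (u : ℝ → ℝ) (hext : AtomCooling.IsExtremal u₁ u₂ T x u)
    (t t' : ℝ) (htt' : AtomCooling.AreConsecutiveSwitchingTimes u₁ u₂ T u t t') :
    (x t').2 / (x t').1 = -((x t).2 / (x t).1) ∧
    ∀ γ : ℝ, 1 < γ →
      (AtomCooling.IsTransfer u₁ u₂ γ T x u → (x t).2 / (x t).1 ≠ 0) ∧
      (AtomCooling.IsTimeOptimal u₁ u₂ γ T x u → x t' ≠ ((x t).1, -(x t).2)) := by
  obtain ⟨hx, l₀, l, hl⟩ := hext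
  have hu : -u₁ < u₂ := by linarith
  refine ⟨htt'.ratio_eq_neg hx hl hu, fun γ _ => ⟨fun htr => ?_, fun hopt =>
    hopt.not_symmetric hl hu htt'⟩⟩
  exact div_ne_zero (htt'.1.state_snd_ne_zero hx hl (by linarith) (by linarith)
    (by rw [htr.2.1]) (by rw [htr.2.2])) (hx.state_pos t (Ioo_subset_Icc_self htt'.1.1)).ne'
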